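/- Let $C=(\mathbb{Z}/2\mathbb{Z})^4$ with canonical basis $e_1,e_2,e_3,e_4$, and let permutations of the basis act on $C$ as linear automorphisms. Let $A=C\rtimes(\langle x\rangle\times\langle y\rangle)$, where $\langle x\rangle\times\langle y\rangle\simeq(\mathbb{Z}/2\mathbb{Z})^2$, $x$ acts on $C$ as $(e_1\ e_2)$ and $y$ acts on $C$ as $(e_3\ e_4)$. Let $B=C\rtimes\langle z\rangle$, where $\langle z\rangle\simeq\mathbb{Z}/3\mathbb{Z}$ and $z$ acts on $C$ as the $3$-cycle $(e_1\ e_2\ e_3)$. Let $G=A\ast_C B$ be the amalgamated product, and regard $x,y$ as elements of $G$. Call a first-order formula in the language of groups existential if it consists of existential quantifiers followed by a quantifier-free formula; two tuples of elements of $G$ have the same $\exists$-type if they satisfy the same existential formulas in $G$; and $G$ is $\exists$-homogeneous if any two finite tuples of elements of $G$ of the same length with the same $\exists$-type are mapped one to the other by an automorphism of $G$. Then: 1. $A$ and $B$ are finite, and $G$ is virtually free, i.e. $G$ is finitely generated and has a free subgroup of finite index; 2. there is an injective homomorphism $\phi:G\to G$ with $\phi(x)=y$ and $\phi(y)=x$;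 3. $x$ and $y$ have the same $\exists$-type; 4. no automorphism of $G$ maps $x$ to $y$; 5. $G$ is not $\exists$-homogeneous. -/

import Mathlib

namespace ExistsHomogeneity

/-! ### First-order logic in groups -/

/-- The function symbols of the language of groups: `1`, `⁻¹` and `·`. -/
inductive GroupFunc : ℕ → Type
  | one : GroupFunc 0
  | inv : GroupFunc 1
  | mul : GroupFunc 2

/-- The first-order language of groups. -/
def groupLanguage : FirstOrder.Language where
  Functions := GroupFunc
  Relations := fun _ => Empty

/-- Every group is a structure for the language of groups, in the obvious way. -/
instance groupStructure (G : Type) [Group G] : groupLanguage.Structure G where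
  funMap := fun {_} f =>
    match f with
    | GroupFunc.one => fun _ => 1
    | GroupFunc.inv => fun a => (a 0)⁻¹
    | GroupFunc.mul => fun a => a 0 * a 1
  RelMap := fun {_} r => r.elim

/-- Two `k`-tuples have the same `∃`-type if they satisfy the same existential formulas. -/
def SameExistsType {G : Type} [Group G] {k : ℕ} (u v : Fin k → G) : Prop :=
  ∀ θ : groupLanguage.Formula (Fin k),
    FirstOrder.Language.BoundedFormula.IsExistential θ → (θ.Realize u ↔ θ.Realize v)

/-- A group is `∃`-homogeneous if any two finite tuples with the same `∃`-type are in the same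
orbit of its automorphism group. -/
def IsExistsHomogeneous (G : Type) [Group G] : Prop :=
  ∀ (k : ℕ) (u v : Fin k → G), SameExistsType u v → ∃ σ : G ≃* G, ∀ i, σ (u i) = v i

/-- A virtually free group: finitely generated, with a free subgroup of finite index. -/
def IsVirtuallyFree (G : Type) [Group G] : Prop :=
  Group.FG G ∧ ∃ H : Subgroup G, H.FiniteIndex ∧ IsFreeGroup H

/-! ### Amalgamated products of two groups -/

section Amalgam

variable {A B C : Type} [Group A] [Group B] [Group C]

/-- The family with the two members `A` and `B`. -/
abbrev Factor (A B : Type) : Bool → Type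
  | false => A
  | true => B

@[reducible] instance factorGroup : ∀ i, Group (Factor A B i)
  | false => ‹Group A›
  | true => ‹Group B›

/-- The family with the two members `f : C →* A` and `g : C →* B`. -/
abbrev factorMap (f : C →* A) (g : C →* B) : ∀ i, C →* Factor A B i
  | false => f
  | true => g

/-- The amalgamated product `A *_C B` along `f : C →* A` and `g : C →* B`. -/
abbrev AmalgamatedProduct (f : C →* A) (g : C →* B) : Type :=
  Monoid.PushoutI (factorMap f g)

/-- The canonical map from the left factor. -/
def AmalgamatedProduct.left (f : C →* A) (g : C →* B) : A →* AmalgamatedProduct f g :=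
  Monoid.PushoutI.of (φ := factorMap f g) false

/-- The canonical map from the right factor. -/
def AmalgamatedProduct.right (f : C →* A) (g : C →* B) : B →* AmalgamatedProduct f g :=
  Monoid.PushoutI.of (φ := factorMap f g) true

end Amalgam

/-! ### The group -/

/-- The cyclic group of order `n`, written multiplicatively. -/
abbrev Cyc (n : ℕ) : Type := Multiplicative (ZMod n)

/-- `C = (ℤ/2)⁴`, written multiplicatively. -/
abbrev C : Type := Fin 4 → Cyc 2

/-- The canonical basis of `C`, indexed by `0, 1, 2, 3`. -/
def e (i : Fin 4) : C := Pi.mulSingle i (Multiplicative.ofAdd 1)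

/-- The action of the symmetric group on `C` by permutation of the canonical basis. -/
def permAut : Equiv.Perm (Fin 4) →* MulAut C := mulAutArrow

theorem permAut_e (s : Equiv.Perm (Fin 4)) (i : Fin 4) : permAut s (e i) = e (s i) := by
  revert s i
  decide

/-- `(ℤ/2)² → S₄`, sending the first generator to the transposition of the first two indices and
the second generator to the transposition of the last two. -/
def permV : Cyc 2 × Cyc 2 →* Equiv.Perm (Fin 4) where
  toFun p := Equiv.swap 0 1 ^ p.1.toAdd.val * Equiv.swap 2 3 ^ p.2.toAdd.val
  map_one' := by decide
  map_mul' := by decide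

/-- `ℤ/3 → S₄`, sending the generator to the 3-cycle `0 ↦ 1 ↦ 2 ↦ 0`. -/
def permZ : Cyc 3 →* Equiv.Perm (Fin 4) where
  toFun k := (c[0, 1, 2] : Equiv.Perm (Fin 4)) ^ k.toAdd.val
  map_one' := by decide
  map_mul' := by decide

/-- `A = C ⋊ (ℤ/2)²`. -/
abbrev A : Type := C ⋊[permAut.comp permV] (Cyc 2 × Cyc 2)

/-- `B = C ⋊ ℤ/3`. -/
abbrev B : Type := C ⋊[permAut.comp permZ] Cyc 3

/-- The inclusion of `C` in `A`. -/
abbrev inclA : C →* A := SemidirectProduct.inl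

/-- The inclusion of `C` in `B`. -/
abbrev inclB : C →* B := SemidirectProduct.inl

/-- `G = A *_C B`. -/
abbrev G : Type := AmalgamatedProduct inclA inclB

/-- The generator of the first factor of `(ℤ/2)²`, as an element of `G`. -/
def x : G :=
  AmalgamatedProduct.left inclA inclB (SemidirectProduct.inr (Multiplicative.ofAdd 1, 1))

/-- The generator of the second factor of `(ℤ/2)²`, as an element of `G`. -/
def y : G :=
  AmalgamatedProduct.left inclA inclB (SemidirectProduct.inr (1, Multiplicative.ofAdd 1))

end ExistsHomogeneity

/-! Write `V` for `Cyc 2 × Cyc 2`. The group `G` is a semidirect product of `C` by `Q = V ∗ ℤ/3`,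
which acts on the basis of `C` through `perm : Q → S₄`. Commutators of nontrivial elements of `V`
and `ℤ/3` freely generate a finite-index subgroup of `Q`, so `G` is virtually free.

Exchanging `x` and `y` and sending `z` to its conjugate by `u = z * y` is injective on `Q` by normal
forms. It conjugates `perm` by a 4-cycle, so it extends to an injective `endo` of `G`. Existential
formulas pass along embeddings, so `x` and `y` have the same `∃`-type.

An automorphism with `x ↦ y` preserves `C` (`proj_mulEquiv_baseG`) and the kernel of the action on
`C`, and induces a surjection `f` of `Q`. Centralizers and torsion in free products give `f V ⊆ V`
and `f z` conjugate into `ℤ/3`; surjectivity forces `f z = v * k * v⁻¹` with `v ∈ V`, `k ∈ ℤ/3`. But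
`(x * z)²` acts trivially on `C`, while `(y * v * k * v⁻¹)²` does not. -/

namespace FreeProduct

open Monoid Monoid.Coprod

variable {M N : Type*} [Group M] [Group N]

/-! ### Normal forms in a free product -/

/-- A product of a nontrivial element of `N` and a nontrivial element of `M`. -/
abbrev Syllable (M N : Type*) [Group M] [Group N] := {n : N // n ≠ 1} × {m : M // m ≠ 1}

/-- The product in `M ∗ N` of a list of syllables. -/
def syllableProd (l : List (Syllable M N)) : Coprod M N :=
  (l.map fun p => inr (p.1 : N) * inl (p.2 : M)).prod

@[simp] theorem syllableProd_nil : syllableProd ([] : List (Syllable M N)) = 1 := rfl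

@[simp] theorem syllableProd_cons (p : Syllable M N) (l : List (Syllable M N)) :
    syllableProd (p :: l) = inr (p.1 : N) * inl (p.2 : M) * syllableProd l := by
  simp [syllableProd]

@[simp] theorem syllableProd_append (l l' : List (Syllable M N)) :
    syllableProd (l ++ l') = syllableProd l * syllableProd l' := by
  simp [syllableProd]

/-- Normal forms of elements of `M ∗ N`: an element of `M`, a list of syllables and an
element of `N`. -/
abbrev NormalForm (M N : Type*) [Group M] [Group N] := M × List (Syllable M N) × N

/-- The element of `M ∗ N` with a given normal form. -/
def NormalForm.eval (t : NormalForm M N) : Coprod M N :=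
  inl t.1 * syllableProd t.2.1 * inr t.2.2

open Classical in
/-- Left multiplication of a normal form by an element of `N`. -/
noncomputable def smulRight (n : N) : NormalForm M N → NormalForm M N
  | (m, l, k) =>
    if hm : m ≠ 1 then
      if hn : n ≠ 1 then (1, (⟨n, hn⟩, ⟨m, hm⟩) :: l, k) else (m, l, k)
    else match l with
      | [] => (1, [], n * k)
      | (a, b) :: l' => if h : n * a ≠ 1 then (1, (⟨n * a, h⟩, b) :: l', k) else (b, l', k)

theorem smulRight_one (t : NormalForm M N) : smulRight 1 t = t := by
  obtain ⟨m, l, k⟩ := t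
  rcases l with _ | ⟨⟨⟨a, ha⟩, b⟩, l⟩ <;> by_cases hm : m = 1 <;> simp_all [smulRight]

theorem smulRight_mul (n n' : N) (t : NormalForm M N) :
    smulRight (n * n') t = smulRight n (smulRight n' t) := by
  obtain ⟨m, l, k⟩ := t
  by_cases hm : m = 1
  · subst hm
    rcases l with _ | ⟨⟨⟨a, ha⟩, ⟨b, hb⟩⟩, l⟩
    · simp [smulRight, mul_assoc]
    · by_cases h : n' * a = 1
      · by_cases hn : n = 1 <;> simp [smulRight, mul_assoc, h, hb, hn]
      · by_cases hn : n * (n' * a) = 1 <;> simp [smulRight, mul_assoc, h, hn]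
  · by_cases hn' : n' = 1
    · simp [hn', smulRight_one]
    · by_cases hn : n * n' = 1 <;> simp [smulRight, hm, hn', hn]

/-- The action of `M ∗ N` on normal forms by left multiplication. -/
noncomputable def act : Coprod M N →* Function.End (NormalForm M N) :=
  Coprod.lift
    { toFun := fun m t => (m * t.1, t.2)
      map_one' := by funext t; simp [Function.End.one_def]
      map_mul' := fun m m' => by funext t; exact Prod.ext (mul_assoc m m' t.1) rfl }
    { toFun := smulRight
      map_one' := by funext t; exact smulRight_one t
      map_mul' := fun n n' => by funext t; exact smulRight_mul n n' t }

theorem act_inl (m : M) (t : NormalForm M N) : act (inl m) t = (m * t.1, t.2) := by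
  rw [act, Coprod.lift_apply_inl]; rfl

theorem act_inr (n : N) (t : NormalForm M N) : act (inr n) t = smulRight n t := by
  rw [act, Coprod.lift_apply_inr]; rfl

theorem act_mul (p q : Coprod M N) (t : NormalForm M N) : act (p * q) t = act p (act q t) := by
  rw [map_mul]; rfl

theorem eval_act (q : Coprod M N) (t : NormalForm M N) : (act q t).eval = q * t.eval := by
  induction q using Coprod.induction_on generalizing t with
  | inl m => simp [act_inl, NormalForm.eval, mul_assoc]
  | inr n =>
    rw [act_inr]
    obtain ⟨m, l, k⟩ := t
    by_cases hm : m = 1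
    · subst hm
      rcases l with _ | ⟨⟨⟨a, ha⟩, ⟨b, hb⟩⟩, l⟩
      · simp [smulRight, NormalForm.eval]
      · by_cases h : n * a = 1
        · have h' : (inr n * inr a : Coprod M N) = 1 := by rw [← map_mul, h, map_one]
          simp [smulRight, NormalForm.eval, h, ← mul_assoc, h']
        · simp [smulRight, NormalForm.eval, h, mul_assoc]
    · by_cases hn : n = 1 <;> simp [smulRight, NormalForm.eval, hm, hn, mul_assoc]
  | mul p q hp hq => rw [act_mul, hp, hq, mul_assoc]

theorem act_syllableProd (l : List (Syllable M N)) (k : N) :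
    act (syllableProd l) (1, [], k) = (1, l, k) := by
  induction l with
  | nil => simp [Function.End.one_def]
  | cons p l ih =>
    obtain ⟨⟨a, ha⟩, ⟨b, hb⟩⟩ := p
    simp [act_mul, ih, act_inl, act_inr, smulRight, ha, hb]

/-- Van der Waerden's argument: acting on the trivial normal form recovers `t` from `t.eval`, hence
uniqueness of normal forms. -/
theorem act_eval (t : NormalForm M N) : act t.eval (1, [], 1) = t := by
  obtain ⟨m, l, k⟩ := t
  have h : act (inr k) ((1, [], 1) : NormalForm M N) = (1, [], k) := by
    simp [act_inr, smulRight]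
  simp [NormalForm.eval, act_mul, h, act_syllableProd, act_inl]

theorem eval_injective : Function.Injective (NormalForm.eval (M := M) (N := N)) :=
  fun s t h => by rw [← act_eval s, h, act_eval]

theorem eval_surjective (q : Coprod M N) :
    ∃ m l n, q = inl m * syllableProd l * inr n := by
  have := eval_act q (1, [], 1)
  simp only [NormalForm.eval, map_one, syllableProd_nil, mul_one] at this
  exact ⟨_, _, _, this.symm⟩

theorem normalForm_ext {m m' : M} {l l' : List (Syllable M N)} {n n' : N}
    (h : inl m * syllableProd l * inr n = inl m' * syllableProd l' * inr n') :
    m = m' ∧ l = l' ∧ n = n' := by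
  have := eval_injective (a₁ := (m, l, n)) (a₂ := (m', l', n')) h
  simpa using this

/-! ### Centralizers and torsion in a free product -/

theorem commute_inl {m : M} (hm : m ≠ 1) {q : Coprod M N}
    (h : inl m * q = q * inl m) : ∃ m', q = inl m' := by
  obtain ⟨m', l, n, rfl⟩ := eval_surjective q
  -- Right multiplication by `m` leaves the leading component `m'` unchanged unless `l = []` and `n
  -- = 1`; left multiplication turns it into `m * m'`.
  by_cases hn : n = 1
  · subst hn
    rcases List.eq_nil_or_concat l with rfl | ⟨l, ⟨⟨a, ha⟩, ⟨b, hb⟩⟩, rfl⟩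
    · exact ⟨m', by simp⟩
    · exfalso
      by_cases hbm : b * m = 1
      · have := normalForm_ext (m := m * m') (l := l ++ [(⟨a, ha⟩, ⟨b, hb⟩)]) (n := 1)
          (m' := m') (l' := l) (n' := a) (by
            have h' : (inl b * inl m : Coprod M N) = 1 := by rw [← map_mul, hbm, map_one]
            simpa [mul_assoc, h'] using h)
        simp [hm] at this
      · have := normalForm_ext (m := m * m') (l := l ++ [(⟨a, ha⟩, ⟨b, hb⟩)]) (n := 1)
          (m' := m') (l' := l ++ [(⟨a, ha⟩, ⟨b * m, hbm⟩)]) (n' := 1) (by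
            simpa [mul_assoc] using h)
        simp [hm] at this
  · exfalso
    have := normalForm_ext (m := m * m') (l := l) (n := n)
      (m' := m') (l' := l ++ [(⟨n, hn⟩, ⟨m, hm⟩)]) (n' := 1) (by simpa [mul_assoc] using h)
    simp [hm] at this

theorem isConj_of_eq {G : Type*} [Group G] {a b : G} (h : a = b) : IsConj a b :=
  h ▸ IsConj.refl a

/-- Cyclic reduction: when `n` or `m` is trivial, letters that are adjacent in the cyclic word
merge, or cancel and leave a shorter word. In the last alternative powers are concatenations, so the
order is infinite. -/
theorem conj_cases_aux (k : ℕ) : ∀ l : List (Syllable M N), l.length ≤ k → ∀ (m : M) (n : N),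
    (∃ m', IsConj (syllableProd l * inr n * inl m) (inl m')) ∨
    (∃ n', IsConj (syllableProd l * inr n * inl m) (inr n')) ∨
    ∃ l' : List (Syllable M N), l' ≠ [] ∧
      IsConj (syllableProd l * inr n * inl m) (syllableProd l') := by
  induction k with
  | zero =>
    intro l hl m n
    obtain rfl : l = [] := by simpa using hl
    by_cases hn : n = 1
    · exact .inl ⟨m, isConj_of_eq (by simp [hn])⟩
    by_cases hm : m = 1
    · exact .inr (.inl ⟨n, isConj_of_eq (by simp [hm])⟩)
    · exact .inr (.inr ⟨[(⟨n, hn⟩, ⟨m, hm⟩)], by simp, isConj_of_eq (by simp)⟩)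
  | succ k ih =>
    intro l hl m n
    by_cases hl0 : l = []
    · exact ih l (by simp [hl0]) m n
    by_cases hn : n = 1
    · subst hn
      obtain ⟨l, ⟨⟨a, ha⟩, ⟨b, hb⟩⟩, rfl⟩ := (List.eq_nil_or_concat l).resolve_left hl0
      by_cases hbm : b * m = 1
      · have h' : (inl b * inl m : Coprod M N) = 1 := by rw [← map_mul, hbm, map_one]
        have := ih l (by simp at hl; omega) 1 a
        simpa [mul_assoc, h'] using this
      · exact .inr (.inr ⟨l ++ [(⟨a, ha⟩, ⟨b * m, hbm⟩)], by simp,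
          isConj_of_eq (by simp [mul_assoc])⟩)
    by_cases hm : m = 1
    · subst hm
      rcases l with _ | ⟨⟨⟨a, ha⟩, ⟨b, hb⟩⟩, l⟩
      · exact absurd rfl hl0
      have hc : IsConj (syllableProd ((⟨a, ha⟩, ⟨b, hb⟩) :: l) * inr n * inl (1 : M))
          (inr (n * a) * inl b * syllableProd l) :=
        isConj_iff.2 ⟨inr n, by simp [mul_assoc]⟩
      by_cases hna : n * a = 1
      · have hc' : IsConj (syllableProd ((⟨a, ha⟩, ⟨b, hb⟩) :: l) * inr n * inl (1 : M))
            (syllableProd l * inr 1 * inl b) :=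
          hc.trans (isConj_iff.2 ⟨inl b⁻¹, by simp [hna]⟩)
        rcases ih l (by simp at hl; omega) b 1 with ⟨m', h⟩ | ⟨n', h⟩ | ⟨l', h0, h⟩
        · exact .inl ⟨m', hc'.trans h⟩
        · exact .inr (.inl ⟨n', hc'.trans h⟩)
        · exact .inr (.inr ⟨l', h0, hc'.trans h⟩)
      · exact .inr (.inr ⟨(⟨n * a, hna⟩, ⟨b, hb⟩) :: l, by simp, by simpa using hc⟩)
    · exact .inr (.inr ⟨l ++ [(⟨n, hn⟩, ⟨m, hm⟩)], by simp, isConj_of_eq (by simp [mul_assoc])⟩)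

theorem conj_cases (q : Coprod M N) :
    (∃ m, IsConj q (inl m)) ∨ (∃ n, IsConj q (inr n)) ∨
    ∃ l : List (Syllable M N), l ≠ [] ∧ IsConj q (syllableProd l) := by
  obtain ⟨m, l, n, rfl⟩ := eval_surjective q
  have hc : IsConj (inl m * syllableProd l * inr n) (syllableProd l * inr n * inl m) :=
    isConj_iff.2 ⟨inl m⁻¹, by simp [mul_assoc]⟩
  rcases conj_cases_aux _ l le_rfl m n with ⟨m', h⟩ | ⟨n', h⟩ | ⟨l', h0, h⟩
  · exact .inl ⟨m', hc.trans h⟩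
  · exact .inr (.inl ⟨n', hc.trans h⟩)
  · exact .inr (.inr ⟨l', h0, hc.trans h⟩)

theorem syllableProd_pow (l : List (Syllable M N)) (k : ℕ) :
    syllableProd l ^ k = syllableProd (List.replicate k l).flatten := by
  induction k with
  | zero => simp
  | succ k ih => simp [pow_succ', ih, List.replicate_succ]

theorem syllableProd_ne_one {l : List (Syllable M N)} (hl : l ≠ []) : syllableProd l ≠ 1 :=
  fun h => hl (normalForm_ext (m := 1) (m' := 1) (n := 1) (n' := 1) (l := l) (l' := [])
    (by simpa using h)).2.1

/-- Elements of finite order of a free product are conjugate into a factor. -/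
theorem conj_of_pow_eq_one {q : Coprod M N} {k : ℕ} (hk : k ≠ 0) (h : q ^ k = 1) :
    (∃ m, IsConj q (inl m)) ∨ (∃ n, IsConj q (inr n)) := by
  rcases conj_cases q with hm | hn | ⟨l, hl, hc⟩
  · exact .inl hm
  · exact .inr hn
  · exfalso
    obtain ⟨g, hg⟩ := isConj_iff.1 hc
    have : syllableProd l ^ k = 1 := by rw [← hg, conj_pow, h]; simp
    rw [syllableProd_pow] at this
    exact syllableProd_ne_one (by simp [hk, hl]) this

/-! ### Endomorphisms conjugating one factor -/

/-- The list of syllables of `u * n * u⁻¹ * m`, where `u` is the product of `l`. -/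
def conjSyllables : List (Syllable M N) → {n : N // n ≠ 1} → {m : M // m ≠ 1} →
    List (Syllable M N)
  | [], n, m => [(n, m)]
  | (a, b) :: l, n, m =>
    (a, b) :: (conjSyllables l n ⟨(b : M)⁻¹, inv_ne_one.2 b.2⟩ ++
      [(⟨(a : N)⁻¹, inv_ne_one.2 a.2⟩, m)])

theorem syllableProd_conjSyllables (l : List (Syllable M N)) (n : {n : N // n ≠ 1})
    (m : {m : M // m ≠ 1}) :
    syllableProd (conjSyllables l n m) =
      syllableProd l * inr (n : N) * (syllableProd l)⁻¹ * inl (m : M) := by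
  induction l generalizing m with
  | nil => simp [conjSyllables]
  | cons p l ih => simp [conjSyllables, ih, mul_assoc]

/-- The endomorphism of `M ∗ N` that is `α` on `M` and conjugation by `u` on `N`. -/
def twist (α : M →* M) (u : Coprod M N) : Coprod M N →* Coprod M N :=
  Coprod.lift (inl.comp α) ((MulAut.conj u).toMonoidHom.comp inr)

@[simp] theorem twist_inl (α : M →* M) (u : Coprod M N) (m : M) :
    twist α u (inl m) = inl (α m) := by simp [twist]

@[simp] theorem twist_inr (α : M →* M) (u : Coprod M N) (n : N) :
    twist α u (inr n) = u * inr n * u⁻¹ := by simp [twist]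

variable {α : M →* M}

theorem twist_syllableProd (hα : Function.Injective α) (l₀ l : List (Syllable M N)) :
    ∃ l' : List (Syllable M N), (l' = [] → l = []) ∧
      twist α (syllableProd l₀) (syllableProd l) = syllableProd l' := by
  induction l with
  | nil => exact ⟨[], by simp⟩
  | cons p l ih =>
    obtain ⟨l', -, h⟩ := ih
    refine ⟨conjSyllables l₀ p.1 ⟨α p.2, (map_ne_one_iff α hα).2 p.2.2⟩ ++ l', ?_, ?_⟩
    · rcases l₀ with _ | ⟨p, l₀⟩ <;> simp [conjSyllables]
    · simp [syllableProd_conjSyllables, h]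

/-- A nonempty `u` starts in `N` and ends in `M`, so nothing cancels in `u * n * u⁻¹` or next to
letters of `M`. A nontrivial trailing `n'` therefore comes with a nonempty `l'`, which gives both
injectivity and `inr n` missing from the range. -/
theorem twist_normalForm (hα : Function.Injective α) {l₀ : List (Syllable M N)} (hl₀ : l₀ ≠ [])
    (m : M) (l : List (Syllable M N)) (n : N) : ∃ (l' : List (Syllable M N)) (n' : N),
      (l' = [] → l = [] ∧ n = 1 ∧ n' = 1) ∧
      twist α (syllableProd l₀) (inl m * syllableProd l * inr n) =
        inl (α m) * syllableProd l' * inr n' := by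
  obtain ⟨l', h', h⟩ := twist_syllableProd hα l₀ l
  by_cases hn : n = 1
  · exact ⟨l', 1, fun h0 => ⟨h' h0, hn, rfl⟩, by simp [h, hn]⟩
  · rcases l₀ with _ | ⟨⟨a, b⟩, l₀⟩
    · exact absurd rfl hl₀
    · refine ⟨l' ++ (a, b) :: conjSyllables l₀ ⟨n, hn⟩ ⟨(b : M)⁻¹, inv_ne_one.2 b.2⟩,
        (a : N)⁻¹, by simp, ?_⟩
      rw [map_mul, map_mul, h]
      simp [syllableProd_conjSyllables, mul_assoc]

theorem twist_injective (hα : Function.Injective α) {l₀ : List (Syllable M N)} (hl₀ : l₀ ≠ []) :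
    Function.Injective (twist α (syllableProd l₀)) := by
  refine (injective_iff_map_eq_one _).2 fun q hq => ?_
  obtain ⟨m, l, n, rfl⟩ := eval_surjective q
  obtain ⟨l', n', h0, h⟩ := twist_normalForm hα hl₀ m l n
  rw [h] at hq
  obtain ⟨hm, hl', -⟩ := normalForm_ext (m' := (1 : M)) (l' := []) (n' := (1 : N))
    (by simpa using hq)
  obtain ⟨rfl, rfl, -⟩ := h0 hl'
  simp [(map_eq_one_iff α hα).1 hm]

theorem inr_notMem_range_twist (hα : Function.Injective α) {l₀ : List (Syllable M N)}
    (hl₀ : l₀ ≠ []) {n : N} (hn : n ≠ 1) :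
    inr n ∉ (twist α (syllableProd l₀)).range := by
  rintro ⟨q, hq⟩
  obtain ⟨m, l, k, rfl⟩ := eval_surjective q
  obtain ⟨l', n', h0, h⟩ := twist_normalForm hα hl₀ m l k
  rw [h] at hq
  obtain ⟨-, hl', hn'⟩ := normalForm_ext (m' := (1 : M)) (l' := []) (n' := n) (by simpa using hq)
  exact hn (hn' ▸ (h0 hl').2.2)

end FreeProduct

namespace FreeProduct

open Monoid Monoid.Coprod

variable {M N : Type*} [Group M] [Group N]

/-! ### A free subgroup generated by commutators -/

/-- The twisted commutator `n⁻¹ * m⁻¹ * n * m` in `M ∗ N`. -/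
def comm (m : M) (n : N) : Coprod M N := inr n⁻¹ * inl m⁻¹ * inr n * inl m

/-- The homomorphism from the free group on pairs of nontrivial elements to `M ∗ N` that sends
pairs to commutators. -/
def commHom : FreeGroup (Syllable M N) →* Coprod M N :=
  FreeGroup.lift fun p => comm (p.2 : M) (p.1 : N)

open Classical in
/-- The element of the free group that `commHom` sends to `comm m n`. -/
noncomputable def commGen (m : M) (n : N) : FreeGroup (Syllable M N) :=
  if h : n ≠ 1 ∧ m ≠ 1 then FreeGroup.of (⟨n, h.1⟩, ⟨m, h.2⟩) else 1

theorem commHom_commGen (m : M) (n : N) : commHom (commGen m n) = comm m n := by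
  by_cases hn : n = 1
  · simp [commGen, comm, hn]
  by_cases hm : m = 1
  · simp [commGen, comm, hm]
  simp [commGen, commHom, hm, hn]

theorem commGen_one_left (n : N) : commGen (1 : M) n = 1 := by simp [commGen]

theorem commGen_one_right (m : M) : commGen m (1 : N) = 1 := by simp [commGen]

/-- The action of `M ∗ N` on the cosets of the range of `commHom`, lifted to a free action. -/
noncomputable def cosetAct : Coprod M N →* Function.End (M × N × FreeGroup (Syllable M N)) :=
  Coprod.lift
    { toFun := fun m t => (m * t.1, t.2)
      map_one' := by funext t; simp [Function.End.one_def]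
      map_mul' := fun m m' => by funext t; exact Prod.ext (mul_assoc m m' t.1) rfl }
    -- A triple `(m, k, f)` stands for `inl m * inr k * commHom f`; moving `n` past `m` costs this
    -- quotient of commutators.
    { toFun := fun n t =>
        (t.1, n * t.2.1, commGen t.1 (n * t.2.1) * (commGen t.1 t.2.1)⁻¹ * t.2.2)
      map_one' := by funext t; simp [Function.End.one_def]
      map_mul' := fun n n' => by
        funext t
        change _ = (_, _, _)
        simp [mul_assoc] }

theorem cosetAct_inl (m : M) (t) : cosetAct (N := N) (inl m) t = (m * t.1, t.2) := by
  rw [cosetAct, Coprod.lift_apply_inl]; rfl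

theorem cosetAct_inr (n : N) (t) : cosetAct (M := M) (inr n) t =
    (t.1, n * t.2.1, commGen t.1 (n * t.2.1) * (commGen t.1 t.2.1)⁻¹ * t.2.2) := by
  rw [cosetAct, Coprod.lift_apply_inr]; rfl

theorem cosetAct_mul (p q : Coprod M N) (t) :
    cosetAct (p * q) t = cosetAct p (cosetAct q t) := by
  rw [map_mul]; rfl

theorem cosetAct_comm (m : M) (n : N) (f) :
    cosetAct (comm m n) (1, 1, f) = (1, 1, commGen m n * f) := by
  simp [-map_inv, comm, cosetAct_mul, cosetAct_inl, cosetAct_inr, commGen_one_left,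
    commGen_one_right]

theorem cosetAct_commHom (w f : FreeGroup (Syllable M N)) :
    cosetAct (commHom w) (1, 1, f) = (1, 1, w * f) := by
  induction w using FreeGroup.induction_on generalizing f with
  | C1 => simp [Function.End.one_def]
  | of p =>
    have : commHom (FreeGroup.of p) = comm (p.2 : M) (p.1 : N) := by simp [commHom]
    rw [this, cosetAct_comm]
    simp [commGen, p.1.2, p.2.2]
  | inv_of p ih =>
    have h := ih ((FreeGroup.of p)⁻¹ * f)
    rw [mul_inv_cancel_left] at h
    rw [← h, ← cosetAct_mul, ← map_mul]
    simp [Function.End.one_def]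
  | mul p q hp hq => rw [map_mul, cosetAct_mul, hq, hp, mul_assoc]

theorem commHom_injective : Function.Injective (commHom (M := M) (N := N)) := fun v w h => by
  have hv := cosetAct_commHom v 1
  rw [h, cosetAct_commHom w 1] at hv
  simpa using hv.symm

theorem exists_eq_mul_commHom (q : Coprod M N) : ∃ m n f, q = inl m * inr n * commHom f := by
  suffices h : ∀ (q : Coprod M N) m n f, ∃ m' n' f',
      q * (inl m * inr n * commHom f) = inl m' * inr n' * commHom f' by
    simpa using h q 1 1 1
  intro q
  induction q using Coprod.induction_on with
  | inl a => exact fun m n f => ⟨a * m, n, f, by simp [mul_assoc]⟩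
  | inr b =>
    refine fun m n f => ⟨m, b * n, commGen m (b * n) * (commGen m n)⁻¹ * f, ?_⟩
    simp [commHom_commGen, comm, mul_assoc]
  | mul p q hp hq =>
    intro m n f
    obtain ⟨m', n', f', h⟩ := hq m n f
    rw [mul_assoc, h]
    exact hp m' n' f'

end FreeProduct

namespace ExistsHomogeneity

open Monoid Monoid.Coprod FreeProduct

/-! ### The extension of `Q` by `C` -/

/-- The free product of the complements of `C` in `A` and in `B`. -/
abbrev Q : Type := Coprod (Cyc 2 × Cyc 2) (Cyc 3)

/-- The inclusion of `C` in `G`. -/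
def baseG : C →* G := PushoutI.base (factorMap inclA inclB)

/-- The projection of `G` onto its quotient by `C`. -/
def proj : G →* Q :=
  PushoutI.lift
    (fun
      | false => (inl : _ →* Q).comp SemidirectProduct.rightHom
      | true => (inr : _ →* Q).comp SemidirectProduct.rightHom)
    1 (by rintro (_ | _) <;> ext <;> simp)

/-- The section of `proj` given by the complements of `C`. -/
def sec : Q →* G :=
  Coprod.lift ((AmalgamatedProduct.left inclA inclB).comp SemidirectProduct.inr)
    ((AmalgamatedProduct.right inclA inclB).comp SemidirectProduct.inr)

/-- The action of `Q` on the basis of `C`. -/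
def perm : Q →* Equiv.Perm (Fin 4) := Coprod.lift permV permZ

@[simp] theorem proj_left (a : A) : proj (AmalgamatedProduct.left inclA inclB a) = inl a.right :=
  PushoutI.lift_of ..

@[simp] theorem proj_right (b : B) :
    proj (AmalgamatedProduct.right inclA inclB b) = inr b.right :=
  PushoutI.lift_of ..

@[simp] theorem proj_baseG (c : C) : proj (baseG c) = 1 := PushoutI.lift_base ..

theorem left_inl (c : C) :
    AmalgamatedProduct.left inclA inclB (SemidirectProduct.inl c) = baseG c :=
  PushoutI.of_apply_eq_base (factorMap inclA inclB) false c

theorem right_inl (c : C) :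
    AmalgamatedProduct.right inclA inclB (SemidirectProduct.inl c) = baseG c :=
  PushoutI.of_apply_eq_base (factorMap inclA inclB) true c

theorem sec_inl (v) : sec (inl v) = AmalgamatedProduct.left inclA inclB (SemidirectProduct.inr v) :=
  Coprod.lift_apply_inl ..

theorem sec_inr (k) :
    sec (inr k) = AmalgamatedProduct.right inclA inclB (SemidirectProduct.inr k) :=
  Coprod.lift_apply_inr ..

@[simp] theorem proj_sec (q : Q) : proj (sec q) = q := by
  suffices h : proj.comp sec = MonoidHom.id Q from DFunLike.congr_fun h q
  apply Coprod.hom_ext <;> ext v <;> simp [sec_inl, sec_inr]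

theorem baseG_injective : Function.Injective baseG :=
  PushoutI.base_injective (φ := factorMap inclA inclB) (by
    rintro (_ | _)
    · exact SemidirectProduct.inl_injective
    · exact SemidirectProduct.inl_injective)

@[simp] theorem perm_inl (v) : perm (inl v) = permV v := Coprod.lift_apply_inl ..

@[simp] theorem perm_inr (k) : perm (inr k) = permZ k := Coprod.lift_apply_inr ..

theorem sec_mul_baseG (q : Q) (c : C) : sec q * baseG c = baseG (permAut (perm q) c) * sec q := by
  induction q using Coprod.induction_on generalizing c with
  | inl v =>
    rw [sec_inl, ← left_inl, ← left_inl, ← map_mul, ← map_mul, perm_inl]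
    congr 1
    ext <;> simp
  | inr k =>
    rw [sec_inr, ← right_inl, ← right_inl, ← map_mul, ← map_mul, perm_inr]
    congr 1
    ext <;> simp
  | mul p q hp hq => rw [map_mul, mul_assoc, hq, ← mul_assoc, hp, map_mul, map_mul, mul_assoc]; rfl

theorem exists_eq_baseG_mul_sec (g : G) : ∃ c q, g = baseG c * sec q := by
  induction g using PushoutI.induction_on with
  | of i g =>
    cases i with
    | false =>
      refine ⟨g.left, inl g.right, ?_⟩
      rw [sec_inl, ← left_inl, ← map_mul, SemidirectProduct.inl_left_mul_inr_right]; rfl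
    | true =>
      refine ⟨g.left, inr g.right, ?_⟩
      rw [sec_inr, ← right_inl, ← map_mul, SemidirectProduct.inl_left_mul_inr_right]; rfl
  | base c => exact ⟨c, 1, by simp [baseG]⟩
  | mul g h hg hh =>
    obtain ⟨c, q, rfl⟩ := hg
    obtain ⟨c', q', rfl⟩ := hh
    refine ⟨c * permAut (perm q) c', q * q', ?_⟩
    rw [map_mul, map_mul, mul_assoc, ← mul_assoc (sec q), sec_mul_baseG]
    simp only [mul_assoc]

theorem eq_baseG_mul_sec_proj (g : G) : ∃ c, g = baseG c * sec (proj g) := by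
  obtain ⟨c, q, rfl⟩ := exists_eq_baseG_mul_sec g
  exact ⟨c, by simp⟩

/-- As `C` is abelian, the `C`-part of `g` does not contribute. -/
theorem conj_baseG (g : G) (c : C) :
    g * baseG c * g⁻¹ = baseG (permAut (perm (proj g)) c) := by
  obtain ⟨d, h⟩ := eq_baseG_mul_sec_proj g
  rw [mul_inv_eq_iff_eq_mul, h, mul_assoc, sec_mul_baseG, ← mul_assoc, ← mul_assoc,
    ← map_mul, ← map_mul, mul_comm]
  simp

instance : Finite A := Finite.of_equiv _ SemidirectProduct.equivProd.symm

instance : Finite B := Finite.of_equiv _ SemidirectProduct.equivProd.symm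

theorem fg_G : Group.FG G := by
  refine Group.fg_iff.2 ⟨Set.range (AmalgamatedProduct.left inclA inclB) ∪
    Set.range (AmalgamatedProduct.right inclA inclB), ?_, Set.toFinite _⟩
  refine eq_top_iff.2 fun g _ => ?_
  induction g using PushoutI.induction_on with
  | of i g =>
    cases i with
    | false => exact Subgroup.subset_closure (.inl ⟨g, rfl⟩)
    | true => exact Subgroup.subset_closure (.inr ⟨g, rfl⟩)
  | base c => exact Subgroup.subset_closure (.inl ⟨_, left_inl c⟩)
  | mul g h hg hh => exact mul_mem (hg trivial) (hh trivial)

theorem isVirtuallyFree_G : IsVirtuallyFree G := by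
  have hinj : Function.Injective (sec.comp (commHom (M := Cyc 2 × Cyc 2) (N := Cyc 3))) :=
    (Function.LeftInverse.injective proj_sec).comp commHom_injective
  refine ⟨fg_G, (sec.comp commHom).range, ?_, IsFreeGroup.ofMulEquiv (MonoidHom.ofInjective hinj)⟩
  have : Finite (G ⧸ (sec.comp (commHom (M := Cyc 2 × Cyc 2) (N := Cyc 3))).range) := by
    refine Finite.of_surjective
      (fun p : C × (Cyc 2 × Cyc 2) × Cyc 3 =>
        ((baseG p.1 * sec (inl p.2.1 * inr p.2.2) : G) : G ⧸ _)) fun g => ?_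
    induction g using QuotientGroup.induction_on with
    | H g =>
      obtain ⟨c, q, rfl⟩ := exists_eq_baseG_mul_sec g
      obtain ⟨v, k, f, rfl⟩ := exists_eq_mul_commHom q
      refine ⟨(c, v, k), QuotientGroup.eq.2 ⟨f, ?_⟩⟩
      simp [mul_assoc]
  exact Subgroup.finiteIndex_of_finite_quotient

end ExistsHomogeneity

namespace ExistsHomogeneity

open Monoid Monoid.Coprod FreeProduct

/-! ### The embedding exchanging `x` and `y` -/

/-- The exchange of the two factors of `(ℤ/2)²`. -/
abbrev swapV : Cyc 2 × Cyc 2 →* Cyc 2 × Cyc 2 := (MulEquiv.prodComm : _ ≃* _).toMonoidHom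

/-- The 4-cycle `0 ↦ 2 ↦ 1 ↦ 3 ↦ 0`. -/
abbrev rot : Equiv.Perm (Fin 4) := c[0, 2, 1, 3]

/-- The syllable `z * y`. -/
abbrev syllableZY : Syllable (Cyc 2 × Cyc 2) (Cyc 3) :=
  (⟨Multiplicative.ofAdd 1, by decide⟩, ⟨(1, Multiplicative.ofAdd 1), by decide⟩)

/-- The endomorphism of `Q` that exchanges `x` and `y` and sends `z` to its conjugate by `z * y`. -/
abbrev endoQ : Q →* Q := twist swapV (syllableProd [syllableZY])

/-- Conjugation by `rot` exchanges `(0 1)` and `(2 3)` and sends `(0 1 2)` to `(1 2 3)`, which is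
also its conjugate by `perm (z * y) = (0 1 2 3)`. This is what dictates the choice of `z * y`. -/
theorem perm_endoQ (q : Q) : perm (endoQ q) = rot * perm q * rot⁻¹ := by
  suffices h : perm.comp endoQ = (MulAut.conj rot).toMonoidHom.comp perm from
    DFunLike.congr_fun h q
  apply Coprod.hom_ext <;> refine MonoidHom.ext fun v => ?_ <;> revert v
  · simp only [MonoidHom.comp_apply, twist_inl, perm_inl]
    decide
  · simp only [MonoidHom.comp_apply, twist_inr, perm_inr, syllableProd_cons, syllableProd_nil,
      map_mul, map_inv, map_one, perm_inl]
    decide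

/-- The restriction of `endo` to `C`. -/
def endoC : C →* G := baseG.comp (permAut rot).toMonoidHom

theorem endoC_permAut (q : Q) (c : C) :
    endoC (permAut (perm q) c) = sec (endoQ q) * endoC c * (sec (endoQ q))⁻¹ := by
  change baseG (permAut rot _) = _ * baseG (permAut rot c) * _
  rw [conj_baseG, proj_sec, perm_endoQ, ← MulAut.mul_apply, ← MulAut.mul_apply, ← map_mul,
    ← map_mul, inv_mul_cancel_right]

/-- The endomorphism of `G` that exchanges `x` and `y`. -/
def endo : G →* G :=
  PushoutI.lift
    (fun
      | false => SemidirectProduct.lift endoC ((sec.comp endoQ).comp inl) fun v => by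
          ext1 c
          have := endoC_permAut (inl v) c
          rw [perm_inl] at this
          exact this
      | true => SemidirectProduct.lift endoC ((sec.comp endoQ).comp inr) fun k => by
          ext1 c
          have := endoC_permAut (inr k) c
          rw [perm_inr] at this
          exact this)
    endoC (by rintro (_ | _) <;> exact SemidirectProduct.lift_comp_inl ..)

theorem endo_baseG (c : C) : endo (baseG c) = baseG (permAut rot c) := PushoutI.lift_base ..

theorem endo_sec (q : Q) : endo (sec q) = sec (endoQ q) := by
  suffices h : endo.comp sec = sec.comp endoQ from DFunLike.congr_fun h q
  apply Coprod.hom_ext <;> refine MonoidHom.ext fun v => ?_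
  · simp only [MonoidHom.comp_apply, sec_inl]
    exact (PushoutI.lift_of ..).trans (SemidirectProduct.lift_inr ..)
  · simp only [MonoidHom.comp_apply, sec_inr]
    exact (PushoutI.lift_of ..).trans (SemidirectProduct.lift_inr ..)

theorem swapV_injective : Function.Injective swapV := Prod.swap_injective

theorem endo_injective : Function.Injective endo := by
  refine (injective_iff_map_eq_one _).2 fun g hg => ?_
  obtain ⟨c, q, rfl⟩ := exists_eq_baseG_mul_sec g
  rw [map_mul, endo_baseG, endo_sec] at hg
  have hq : endoQ q = 1 := by simpa using congrArg proj hg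
  obtain rfl := (map_eq_one_iff _ (twist_injective swapV_injective (by simp))).1 hq
  have hc : baseG (permAut rot c) = 1 := by simpa using hg
  rw [map_eq_one_iff _ baseG_injective, EmbeddingLike.map_eq_one_iff] at hc
  simp [hc]

theorem x_eq : x = sec (inl (Multiplicative.ofAdd 1, 1)) := (sec_inl _).symm

theorem y_eq : y = sec (inl (1, Multiplicative.ofAdd 1)) := (sec_inl _).symm

theorem endo_x : endo x = y := by rw [x_eq, y_eq, endo_sec, twist_inl]; rfl

theorem endo_y : endo y = x := by rw [x_eq, y_eq, endo_sec, twist_inl]; rfl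

/-- An injective homomorphism of groups, as an embedding of structures. -/
def embeddingOfInjective {G : Type} [Group G] (f : G →* G) (hf : Function.Injective f) :
    FirstOrder.Language.Embedding groupLanguage G G where
  toFun := f
  inj' := hf
  map_fun' := fun {_} h v => by
    cases h with
    | one => exact map_one f
    | inv => exact map_inv f _
    | mul => exact map_mul f _ _
  map_rel' := fun {_} r => r.elim

theorem realize_of_injective {G : Type} [Group G] {f : G →* G} (hf : Function.Injective f) {k : ℕ}
    {u : Fin k → G} {θ : groupLanguage.Formula (Fin k)}
    (hθ : FirstOrder.Language.BoundedFormula.IsExistential θ) (h : θ.Realize u) :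
    θ.Realize (f ∘ u) := by
  have := hθ.realize_embedding (embeddingOfInjective f hf) h
  rwa [Subsingleton.elim (_ ∘ default) default] at this

theorem sameExistsType_x_y : SameExistsType ![x] ![y] := fun θ hθ => by
  constructor <;> intro h
  · convert realize_of_injective endo_injective hθ h using 1
    ext i
    simp [endo_x]
  · convert realize_of_injective endo_injective hθ h using 1
    ext i
    simp [endo_y]

/-! ### Automorphisms of `G` -/

theorem e_injective : Function.Injective e := by decide

theorem perm_eq_one_of_commute {g : G} (h : ∀ c, g * baseG c = baseG c * g) :
    perm (proj g) = 1 := by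
  ext1 i
  have := conj_baseG g (e i)
  rw [h, mul_inv_cancel_right] at this
  rw [permAut_e] at this
  exact (e_injective (baseG_injective this)).symm

theorem commute_baseG_of_perm {g : G} (h : perm (proj g) = 1) (c : C) :
    g * baseG c = baseG c * g := by
  have := conj_baseG g c
  rwa [h, map_one, MulAut.one_apply, mul_inv_eq_iff_eq_mul] at this

theorem exists_baseG_eq {g : G} (h : proj g = 1) : ∃ c, baseG c = g := by
  obtain ⟨c, hc⟩ := eq_baseG_mul_sec_proj g
  exact ⟨c, by rw [hc, h, map_one, mul_one]⟩

theorem baseG_sq (c : C) : baseG c ^ 2 = 1 := by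
  rw [← map_pow]
  revert c
  simp only [map_eq_one_iff _ baseG_injective]
  decide

theorem eq_one_of_sq_eq_one : ∀ k : Cyc 3, k ^ 2 = 1 → k = 1 := by decide

theorem eq_one_of_cube_eq_one : ∀ v : Cyc 2 × Cyc 2, v ^ 3 = 1 → v = 1 := by decide

theorem exists_pow_eq : ∀ k : Cyc 3, ∃ n : ℕ, Multiplicative.ofAdd 1 ^ n = k :=
  fun k => ⟨k.toAdd.val, by revert k; decide⟩

/-- The conjugated 3-cycle fixes exactly one of `2`, `3`, so its product with `(2 3)` is a 4-cycle.
-/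
theorem perm_conj_sq_ne_one : ∀ (v : Cyc 2 × Cyc 2) (k : Cyc 3), k ≠ 1 →
    (permV (1, Multiplicative.ofAdd 1) * (permV v * permZ k * (permV v)⁻¹)) ^ 2 ≠ 1 := by
  decide

/-- A normal set of commuting involutions of `Q` is trivial. -/
theorem eq_one_of_normal {S : Set Q} (hsq : ∀ s ∈ S, s ^ 2 = 1)
    (hcomm : ∀ s ∈ S, ∀ t ∈ S, s * t = t * s) (hconj : ∀ s ∈ S, ∀ q, q * s * q⁻¹ ∈ S)
    {s : Q} (hs : s ∈ S) : s = 1 := by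
  rcases conj_of_pow_eq_one two_ne_zero (hsq s hs) with ⟨v, hv⟩ | ⟨k, hk⟩
  · obtain ⟨g, hg⟩ := isConj_iff.1 hv
    have hvS := hconj s hs g
    rw [hg] at hvS
    by_cases hv1 : v = 1
    · simpa [hv1] using hg
    let z : Cyc 3 := Multiplicative.ofAdd 1
    have hz : z ≠ 1 := by decide
    -- Commuting with `v` would put `z * v * z⁻¹` in `V`, against its normal form.
    obtain ⟨v', h⟩ := commute_inl hv1 (hcomm _ hvS _ (hconj _ hvS (inr z)))
    have := normalForm_ext (m := 1) (l := [(⟨z, hz⟩, ⟨v, hv1⟩)]) (n := z⁻¹) (m' := v') (l' := [])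
      (n' := 1) (by simpa using h)
    simp at this
  · obtain ⟨g, hg⟩ := isConj_iff.1 hk
    have h2 : (inr k : Q) ^ 2 = 1 := by rw [← hg, conj_pow, hsq s hs]; simp
    rw [← map_pow, map_eq_one_iff _ inr_injective] at h2
    simpa [eq_one_of_sq_eq_one k h2] using hg

/-- The image of `C` in `Q` is a normal elementary abelian 2-subgroup, hence trivial. So `C` is
characteristic. -/
theorem proj_mulEquiv_baseG (σ : G ≃* G) (c : C) : proj (σ (baseG c)) = 1 := by
  refine eq_one_of_normal (S := Set.range fun c => proj (σ (baseG c))) ?_ ?_ ?_ ⟨c, rfl⟩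
  · rintro _ ⟨c, rfl⟩
    simp only [← map_pow σ, ← map_pow proj, baseG_sq, map_one]
  · rintro _ ⟨c, rfl⟩ _ ⟨d, rfl⟩
    simp only [← map_mul, mul_comm]
  · rintro _ ⟨c, rfl⟩ q
    refine ⟨permAut (perm (proj (σ.symm (sec q)))) c, ?_⟩
    simp [← conj_baseG]

/-- The kernel of `perm ∘ proj` is the centralizer of the characteristic subgroup `C`. -/
theorem perm_proj_mulEquiv (σ : G ≃* G) {g : G} (h : perm (proj g) = 1) :
    perm (proj (σ g)) = 1 := by
  refine perm_eq_one_of_commute fun c => ?_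
  obtain ⟨d, hd⟩ := exists_baseG_eq (proj_mulEquiv_baseG σ.symm c)
  rw [← σ.apply_symm_apply (baseG c), ← hd, ← map_mul, commute_baseG_of_perm h, map_mul]

theorem proj_mulEquiv_sec_surjective (σ : G ≃* G) :
    Function.Surjective ((proj.comp σ.toMonoidHom).comp sec) := fun q => by
  obtain ⟨c, q', h⟩ := exists_eq_baseG_mul_sec (σ.symm (sec q))
  refine ⟨q', ?_⟩
  have := congrArg (fun g => proj (σ g)) h
  simpa [proj_mulEquiv_baseG] using this.symm

theorem not_exists_mulEquiv : ¬ ∃ σ : G ≃* G, σ x = y := by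
  rintro ⟨σ, hσ⟩
  set f : Q →* Q := (proj.comp σ.toMonoidHom).comp sec with hf
  have hsurj : Function.Surjective f := proj_mulEquiv_sec_surjective σ
  let z : Cyc 3 := Multiplicative.ofAdd 1
  have hfx : f (inl (Multiplicative.ofAdd 1, 1)) = inl (1, Multiplicative.ofAdd 1) := by
    simp only [hf, MonoidHom.comp_apply, ← x_eq]
    change proj (σ x) = _
    rw [hσ, y_eq, proj_sec]
  have hfV (v) : ∃ v', f (inl v) = inl v' := by
    refine commute_inl (m := (1, Multiplicative.ofAdd 1)) (by decide) ?_
    rw [← hfx, ← map_mul, ← map_mul, ← map_mul, ← map_mul, mul_comm]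
  have hz3 : f (inr z) ^ 3 = 1 := by
    rw [← map_pow, ← map_pow, show z ^ 3 = 1 by decide, map_one, map_one]
  have hz : perm (f (inr z)) ≠ 1 := fun h => by
    have := perm_proj_mulEquiv σ.symm (g := σ (sec (inr z))) h
    rw [σ.symm_apply_apply, proj_sec, perm_inr] at this
    revert this
    decide
  have hord : ∃ k, IsConj (f (inr z)) (inr k) := by
    refine (conj_of_pow_eq_one three_ne_zero hz3).resolve_left ?_
    rintro ⟨v, hv⟩
    obtain ⟨g, hg⟩ := isConj_iff.1 hv
    have h3 : (inl v : Q) ^ 3 = 1 := by rw [← hg, conj_pow, hz3]; simp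
    rw [← map_pow, map_eq_one_iff _ inl_injective] at h3
    refine hz ?_
    have : f (inr z) = 1 := by simpa [eq_one_of_cube_eq_one v h3] using hg
    rw [this, map_one]
  obtain ⟨k, hk⟩ := hord
  obtain ⟨g, hg⟩ := isConj_iff.1 hk.symm
  obtain ⟨v, l, n, rfl⟩ := eval_surjective g
  -- The trailing `n` of the conjugator commutes with `k` and disappears.
  have hfz : f (inr z) = inl v * twist (MonoidHom.id _) (syllableProd l) (inr k) * (inl v)⁻¹ := by
    rw [← hg, twist_inr]
    have hnk (q : Q) : inr n * (inr k * q) = inr k * (inr n * q) := by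
      rw [← mul_assoc, ← map_mul, mul_comm, map_mul, mul_assoc]
    simp only [mul_inv_rev, mul_assoc, hnk, mul_inv_cancel_left]
  have hl : l = [] := by
    -- Otherwise the image of `f` lies in the range of a twist by a nonempty word, which misses `z`.
    by_contra hl
    set R := (twist (MonoidHom.id (Cyc 2 × Cyc 2)) (syllableProd l)).range with hR
    have hinl (v) : inl v ∈ R := ⟨inl v, by simp⟩
    have hfzR : f (inr z) ∈ R := hfz ▸ mul_mem (mul_mem (hinl v) ⟨_, rfl⟩) (inv_mem (hinl v))
    suffices h : ∀ q, f q ∈ R by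
      obtain ⟨q, hq⟩ := hsurj (inr z)
      exact inr_notMem_range_twist (α := MonoidHom.id _) Function.injective_id hl (n := z)
        (by decide) (hq ▸ h q)
    intro q
    induction q using Coprod.induction_on with
    | inl w =>
      obtain ⟨w', hw⟩ := hfV w
      exact hw ▸ hinl w'
    | inr w =>
      obtain ⟨n, rfl⟩ := exists_pow_eq w
      rw [map_pow, map_pow]
      exact pow_mem hfzR n
    | mul p q hp hq => exact map_mul f p q ▸ mul_mem hp hq
  subst hl
  have hk1 : k ≠ 1 := by
    rintro rfl
    exact hz (by rw [hfz, map_one, map_one, mul_one, mul_inv_cancel, map_one])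
  refine perm_conj_sq_ne_one v k hk1 ?_
  -- `(0 1)(0 1 2)` is a transposition, so `(x * z)²` acts trivially on `C`, and so must its image
  -- under `σ`.
  have h := perm_proj_mulEquiv σ
    (g := sec ((inl (Multiplicative.ofAdd 1, 1) * inr z) ^ 2)) (by
      rw [proj_sec, map_pow, map_mul, perm_inl, perm_inr]
      decide)
  change perm (f _) = 1 at h
  simpa [hfx, hfz, mul_assoc] using h

theorem not_isExistsHomogeneous : ¬ IsExistsHomogeneous G := fun h => by
  obtain ⟨σ, hσ⟩ := h 1 _ _ sameExistsType_x_y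
  exact not_exists_mulEquiv ⟨σ, by simpa using hσ 0⟩

end ExistsHomogeneity

theorem mainTheorem3 :
    (Finite ExistsHomogeneity.A ∧ Finite ExistsHomogeneity.B) ∧
    ExistsHomogeneity.IsVirtuallyFree ExistsHomogeneity.G ∧
    (∃ φ : ExistsHomogeneity.G →* ExistsHomogeneity.G, Function.Injective φ ∧
      φ ExistsHomogeneity.x = ExistsHomogeneity.y ∧
      φ ExistsHomogeneity.y = ExistsHomogeneity.x) ∧
    ExistsHomogeneity.SameExistsType ![ExistsHomogeneity.x] ![ExistsHomogeneity.y] ∧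
    (¬ ∃ σ : ExistsHomogeneity.G ≃* ExistsHomogeneity.G,
      σ ExistsHomogeneity.x = ExistsHomogeneity.y) ∧
    ¬ ExistsHomogeneity.IsExistsHomogeneous ExistsHomogeneity.G := by
  exact ⟨⟨inferInstance, inferInstance⟩, ExistsHomogeneity.isVirtuallyFree_G,
    ⟨ExistsHomogeneity.endo, ExistsHomogeneity.endo_injective, ExistsHomogeneity.endo_x,
      ExistsHomogeneity.endo_y⟩, ExistsHomogeneity.sameExistsType_x_y,
    ExistsHomogeneity.not_exists_mulEquiv, ExistsHomogeneity.not_isExistsHomogeneous⟩
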